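/- Let $x_{t+1}=Ax_t+w_t$, $y_t=Cx_t+r_t$ for $t\ge 0$, with $x_t\in\mathbb{R}^n$, $y_t\in\mathbb{R}^m$, where $x_0,w_0,w_1,\dots,r_0,r_1,\dots$ are mutually independent zero-mean Gaussian vectors (possibly degenerate) with $E[x_0x_0']=\Sigma_0$, $E[w_tw_t']=W$, $E[r_tr_t']=R$. Fix a horizon $T$, a positive definite matrix $\mathsf{Q}$ and finite alphabets $\mathcal{M}_t$, $t\ge 0$. A causal composite quantization policy $\Pi$ is a sequence of measurable maps $Q_t$, generating $q_t=Q_t(y_0,\dots,y_t,q_0,\dots,q_{t-1})\in\mathcal{M}_t$. A receiver policy $\gamma$ is a sequence of measurable maps $\gamma_t$, generating $v_t=\gamma_t(q_0,\dots,q_t)\in\mathbb{R}^n$. The performance of $\Pi$ is $$J(\Pi)=\inf_\gamma E^{\Pi,\gamma}\Big[\sum_{t=0}^{T-1}(x_t-v_t)'\mathsf{Q}(x_t-v_t)\Big].$$ The Kalman filter is defined by $\Sigma_{0|-1}=\Sigma_0$, $\tilde m_{-1}=0$ and, for $t\ge 0$, $$K_t=\Sigma_{t|t-1}C'(C\Sigma_{t|t-1}C'+R)^{-1},\qquad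 \tilde m_t=A\tilde m_{t-1}+K_t\,(y_t-CA\tilde m_{t-1}),$$ $$\Sigma_{t+1|t}=A\Sigma_{t|t-1}A'+W-A\Sigma_{t|t-1}C'(C\Sigma_{t|t-1}C'+R)^{-1}C\Sigma_{t|t-1}A',$$ where the inverse is read as the Moore–Penrose inverse if $C\Sigma_{t|t-1}C'+R$ is singular. Then for every causal composite quantization policy $\Pi$ there is a causal composite quantization policy $\Pi'$ which generates $q_t$ as a measurable function (depending on $t$) of only the Kalman filter output $(\tilde m_t,\Sigma_{t|t-1})$ and the information $q_0,\dots,q_{t-1}$ available at the receiver, such that $J(\Pi')\le J(\Pi)$. -/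

import Mathlib

open MeasureTheory ProbabilityTheory Matrix
open scoped ENNReal

noncomputable section

namespace CausalLQG

/-! ### The linear Gaussian source -/

/-- Labels of the primitive random vectors: the initial state `x₀`, the process noises `w_t`
and the observation noises `r_t`. -/
inductive Source where
  | init : Source
  | proc (t : ℕ) : Source
  | obs (t : ℕ) : Source

/-- Dimension of each primitive random vector (`n` for states, `m` for observations). -/
def Source.dim (n m : ℕ) : Source → ℕ
  | .init => n
  | .proc _ => n
  | .obs _ => m

variable {Ω : Type*} {n m : ℕ}

/-- The family of all primitive random vectors. -/
def primitive (x₀ : Ω → Fin n → ℝ) (w : ℕ → Ω → Fin n → ℝ) (r : ℕ → Ω → Fin m → ℝ) :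
    (k : Source) → Ω → Fin (k.dim n m) → ℝ
  | .init => x₀
  | .proc t => w t
  | .obs t => r t

/-- `X` is a zero-mean (possibly degenerate) Gaussian random vector with `E[X X'] = S`. -/
structure IsCenteredGaussian [MeasurableSpace Ω] (P : Measure Ω) {d : ℕ}
    (X : Ω → Fin d → ℝ) (S : Matrix (Fin d) (Fin d) ℝ) : Prop where
  measurable : Measurable X
  gaussian : HasGaussianLaw X P
  mean_eq_zero : ∀ i, ∫ ω, X ω i ∂P = 0
  second_moment : ∀ i j, ∫ ω, X ω i * X ω j ∂P = S i j

/-- The initial state and the noises are zero-mean Gaussian with covariances `Σ₀`, `W`, `R`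
respectively, and are all mutually independent. -/
structure IsGaussianSource [MeasurableSpace Ω] (P : Measure Ω)
    (Sig₀ W : Matrix (Fin n) (Fin n) ℝ) (R : Matrix (Fin m) (Fin m) ℝ)
    (x₀ : Ω → Fin n → ℝ) (w : ℕ → Ω → Fin n → ℝ) (r : ℕ → Ω → Fin m → ℝ) : Prop where
  init : IsCenteredGaussian P x₀ Sig₀
  proc : ∀ t, IsCenteredGaussian P (w t) W
  obs : ∀ t, IsCenteredGaussian P (r t) R
  indep : iIndepFun (primitive x₀ w r) P

/-- The state process `x_{t+1} = A x_t + w_t`. -/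
def state (A : Matrix (Fin n) (Fin n) ℝ) (x₀ : Ω → Fin n → ℝ) (w : ℕ → Ω → Fin n → ℝ) :
    ℕ → Ω → Fin n → ℝ
  | 0 => x₀
  | t + 1 => fun ω => A *ᵥ state A x₀ w t ω + w t ω

/-- The observation process `y_t = C x_t + r_t`. -/
def observation (A : Matrix (Fin n) (Fin n) ℝ) (C : Matrix (Fin m) (Fin n) ℝ)
    (x₀ : Ω → Fin n → ℝ) (w : ℕ → Ω → Fin n → ℝ) (r : ℕ → Ω → Fin m → ℝ)
    (t : ℕ) (ω : Ω) : Fin m → ℝ :=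
  C *ᵥ state A x₀ w t ω + r t ω

/-! ### The Kalman filter -/

/-- Inverse of a symmetric matrix on its range, zero on its kernel (the Moore–Penrose inverse).
It is the ordinary inverse when the matrix is invertible, see `symmPinv_eq_inv`. -/
def symmPinv {d : ℕ} (S : Matrix (Fin d) (Fin d) ℝ) : Matrix (Fin d) (Fin d) ℝ :=
  cfc (fun x : ℝ => x⁻¹) S

theorem symmPinv_eq_inv {d : ℕ} (S : Matrix (Fin d) (Fin d) ℝ) (hS : S.IsSymm)
    (hdet : IsUnit S.det) : symmPinv S = S⁻¹ := by
  have hsa : IsSelfAdjoint S := by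
    change star S = S
    rw [Matrix.star_eq_conjTranspose, Matrix.conjTranspose_eq_transpose_of_trivial]
    exact hS
  have hu : IsUnit S := (Matrix.isUnit_iff_isUnit_det S).2 hdet
  obtain ⟨u, rfl⟩ := hu
  rw [symmPinv, cfc_inv_id u hsa, Matrix.coe_units_inv]

/-- The gain `Σ C' (C Σ C' + R)⁻¹` for a prediction error covariance `Σ`. -/
def kalmanGain (C : Matrix (Fin m) (Fin n) ℝ) (R : Matrix (Fin m) (Fin m) ℝ)
    (Sig : Matrix (Fin n) (Fin n) ℝ) : Matrix (Fin n) (Fin m) ℝ :=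
  Sig * Cᵀ * symmPinv (C * Sig * Cᵀ + R)

/-- The prediction error covariance `Σ_{t|t-1}`, by the Riccati recursion. -/
def predCov (A : Matrix (Fin n) (Fin n) ℝ) (C : Matrix (Fin m) (Fin n) ℝ)
    (Sig₀ W : Matrix (Fin n) (Fin n) ℝ) (R : Matrix (Fin m) (Fin m) ℝ) :
    ℕ → Matrix (Fin n) (Fin n) ℝ
  | 0 => Sig₀
  | t + 1 =>
    A * predCov A C Sig₀ W R t * Aᵀ + W
      - (A * predCov A C Sig₀ W R t * Cᵀ)
        * symmPinv (C * predCov A C Sig₀ W R t * Cᵀ + R)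
        * (C * predCov A C Sig₀ W R t * Aᵀ)

/-- The Kalman filter estimate `m̃_t` of `x_t`, as a function of `y_0, …, y_t`:
`m̃_t = A m̃_{t-1} + K_t (y_t - C A m̃_{t-1})` with `m̃_{-1} = 0`. -/
def kalmanMean (A : Matrix (Fin n) (Fin n) ℝ) (C : Matrix (Fin m) (Fin n) ℝ)
    (Sig₀ W : Matrix (Fin n) (Fin n) ℝ) (R : Matrix (Fin m) (Fin m) ℝ) :
    (t : ℕ) → (Fin (t + 1) → Fin m → ℝ) → Fin n → ℝ
  | 0, y => kalmanGain C R (predCov A C Sig₀ W R 0) *ᵥ y 0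
  | t + 1, y =>
    let pred := A *ᵥ kalmanMean A C Sig₀ W R t (fun s => y s.castSucc)
    pred + kalmanGain C R (predCov A C Sig₀ W R (t + 1)) *ᵥ (y (Fin.last (t + 1)) - C *ᵥ pred)

/-! ### Causal quantization and estimation -/

/-- Strings `q_0, …, q_{t-1}` of quantizer outputs, where `q_s` lies in an alphabet of size
`M s`. -/
abbrev History (M : ℕ → ℕ) (t : ℕ) : Type := (s : Fin t) → Fin (M s)

/-- A causal composite quantization policy with feedback: `q_t` is a measurable function of
`y_0, …, y_t` and `q_0, …, q_{t-1}`. -/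
structure CompositePolicy (m : ℕ) (M : ℕ → ℕ) where
  map : (t : ℕ) → (Fin (t + 1) → Fin m → ℝ) → History M t → Fin (M t)
  measurable_map : ∀ t,
    Measurable (fun p : (Fin (t + 1) → Fin m → ℝ) × History M t => map t p.1 p.2)

/-- A causal receiver policy: `v_t` is a measurable function of `q_0, …, q_t`. -/
structure ReceiverPolicy (n : ℕ) (M : ℕ → ℕ) where
  map : (t : ℕ) → History M (t + 1) → Fin n → ℝ
  measurable_map : ∀ t, Measurable (map t)

/-- The quantizer output `q_t` that a policy generates along an observation sequence. -/
def CompositePolicy.output {M : ℕ → ℕ} (Q : CompositePolicy m M) (y : ℕ → Fin m → ℝ)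
    (t : ℕ) : Fin (M t) :=
  Q.map t (fun s => y s) (fun s => Q.output y s)
termination_by t
decreasing_by exact s.2

/-- The expected cost `E[∑_{t<T} (x_t - v_t)' Qc (x_t - v_t)]`. -/
def cost [MeasurableSpace Ω] (P : Measure Ω) {M : ℕ → ℕ} (T : ℕ)
    (Qc : Matrix (Fin n) (Fin n) ℝ) (x : ℕ → Ω → Fin n → ℝ) (y : ℕ → Ω → Fin m → ℝ)
    (Q : CompositePolicy m M) (g : ReceiverPolicy n M) : ℝ≥0∞ :=
  ∫⁻ ω, ENNReal.ofReal (∑ t ∈ Finset.range T,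
    let v := g.map t (fun s => Q.output (fun u => y u ω) s)
    (x t ω - v) ⬝ᵥ (Qc *ᵥ (x t ω - v))) ∂P

/-- The performance of an encoder: its cost with the best receiver. -/
def performance [MeasurableSpace Ω] (P : Measure Ω) {M : ℕ → ℕ} (T : ℕ)
    (Qc : Matrix (Fin n) (Fin n) ℝ) (x : ℕ → Ω → Fin n → ℝ) (y : ℕ → Ω → Fin m → ℝ)
    (Q : CompositePolicy m M) : ℝ≥0∞ :=
  ⨅ g : ReceiverPolicy n M, cost P T Qc x y Q g

/-- The policy uses only the Kalman filter output `(m̃_t, Σ_{t|t-1})` and the past quantizer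
outputs `q_0, …, q_{t-1}`, which are what the receiver knows. -/
def CompositePolicy.UsesOnlyKalman {M : ℕ → ℕ} (Q : CompositePolicy m M)
    (A : Matrix (Fin n) (Fin n) ℝ) (C : Matrix (Fin m) (Fin n) ℝ)
    (Sig₀ W : Matrix (Fin n) (Fin n) ℝ) (R : Matrix (Fin m) (Fin m) ℝ) : Prop :=
  ∃ F : (t : ℕ) → (Fin n → ℝ) × (Fin n → Fin n → ℝ) × History M t → Fin (M t),
    (∀ t, Measurable (F t)) ∧
    ∀ t (y : Fin (t + 1) → Fin m → ℝ) (q : History M t),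
      Q.map t y q
        = F t (kalmanMean A C Sig₀ W R t y, fun i j => predCov A C Sig₀ W R t i j, q)

end CausalLQG

end

/-! Fix the given encoder and a receiver `g` that is optimal for it. Such a `g` exists because the
alphabets are finite: on each fiber of the quantizer history it outputs the mean of the state over
that fiber (`exists_optimal_receiver`). It is enough to find a Kalman-based encoder that does no
worse against this same `g`, since re-optimizing the receiver can only lower its cost further.

With `g` frozen, the encoder faces a finite-horizon Markov decision problem whose state is the pair
of the filter mean and the past symbols. Two facts give this. The state is the filter mean plus an
error independent of the observations so far (`indepFun_filterError`), so the expected distortion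
depends only on the filter mean and the symbols sent. The next filter mean is a linear function of
the present one plus a gain times an innovation that is independent of the observations so far
(`indepFun_innovation`), so the transition law involves neither the rest of the observations nor the
policy. `lintegral_step` combines the two into one Bellman step.

Backward induction then bounds the cost of every encoder below by the optimal cost-to-go
(`lintegral_sourceCostToGo_le`), and an encoder that selects a minimizing symbol at each stage
attains the bound (`sum_lintegral_eq_sourceCostToGo`). The minimizer depends on the filter mean and
the past symbols only, and is measurable because the alphabet is finite.

The independence claims reduce to vanishing covariances, because all variables are linear in jointly
Gaussian primitives. The covariances come from the filter algebra in `IsGaussianSource.kalman`;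
singular innovation covariances cause no trouble because only the identity S S⁺ S = S and the
degeneracy of Y on the kernel of its covariance are needed. -/

namespace CausalLQG

/-! ### Covariance algebra and least squares with a pseudoinverse -/

section Covariance

/-- The cross-covariance matrix of two random vectors. -/
noncomputable def covMat {Ω : Type*} [MeasurableSpace Ω] (P : Measure Ω) {d e : ℕ}
    (X : Ω → Fin d → ℝ) (Y : Ω → Fin e → ℝ) : Matrix (Fin d) (Fin e) ℝ :=
  Matrix.of fun i j => cov[fun ω => X ω i, fun ω => Y ω j; P]

/-- All coordinates of a random vector lie in a given space of random variables. -/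
def CoordsIn {Ω : Type*} {d : ℕ} (L : Submodule ℝ (Ω → ℝ)) (X : Ω → Fin d → ℝ) : Prop :=
  ∀ i, (fun ω => X ω i) ∈ L

variable {Ω : Type*} {d e f : ℕ} {L L' : Submodule ℝ (Ω → ℝ)}

theorem CoordsIn.mono {X : Ω → Fin d → ℝ} (hX : CoordsIn L X) (h : L ≤ L') : CoordsIn L' X :=
  fun i => h (hX i)

theorem CoordsIn.add {X Y : Ω → Fin d → ℝ} (hX : CoordsIn L X) (hY : CoordsIn L Y) :
    CoordsIn L (fun ω => X ω + Y ω) :=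
  fun i => L.add_mem (hX i) (hY i)

theorem CoordsIn.sub {X Y : Ω → Fin d → ℝ} (hX : CoordsIn L X) (hY : CoordsIn L Y) :
    CoordsIn L (fun ω => X ω - Y ω) :=
  fun i => L.sub_mem (hX i) (hY i)

theorem CoordsIn.mulVec {X : Ω → Fin d → ℝ} (hX : CoordsIn L X) (A : Matrix (Fin e) (Fin d) ℝ) :
    CoordsIn L (fun ω => A *ᵥ X ω) := by
  intro i
  have : (fun ω => (A *ᵥ X ω) i) = ∑ j, A i j • fun ω => X ω j := by
    ext ω; simp [Matrix.mulVec, dotProduct]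
  rw [this]
  exact L.sum_mem fun j _ => L.smul_mem _ (hX j)

variable [MeasurableSpace Ω] {P : Measure Ω}

theorem covMat_transpose (X : Ω → Fin d → ℝ) (Y : Ω → Fin e → ℝ) :
    (covMat P X Y)ᵀ = covMat P Y X := by
  ext i j; exact covariance_comm _ _

theorem covMat_add_left [IsFiniteMeasure P] {X Y : Ω → Fin d → ℝ} {Z : Ω → Fin e → ℝ}
    (hX : ∀ i, MemLp (fun ω => X ω i) 2 P) (hY : ∀ i, MemLp (fun ω => Y ω i) 2 P)
    (hZ : ∀ i, MemLp (fun ω => Z ω i) 2 P) :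
    covMat P (fun ω => X ω + Y ω) Z = covMat P X Z + covMat P Y Z := by
  ext i j; exact covariance_add_left (hX i) (hY i) (hZ j)

theorem covMat_sub_left [IsFiniteMeasure P] {X Y : Ω → Fin d → ℝ} {Z : Ω → Fin e → ℝ}
    (hX : ∀ i, MemLp (fun ω => X ω i) 2 P) (hY : ∀ i, MemLp (fun ω => Y ω i) 2 P)
    (hZ : ∀ i, MemLp (fun ω => Z ω i) 2 P) :
    covMat P (fun ω => X ω - Y ω) Z = covMat P X Z - covMat P Y Z := by
  ext i j; exact covariance_sub_left (hX i) (hY i) (hZ j)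

theorem covMat_mulVec_left [IsFiniteMeasure P] {X : Ω → Fin d → ℝ} {Z : Ω → Fin e → ℝ}
    (hX : ∀ i, MemLp (fun ω => X ω i) 2 P) (hZ : ∀ i, MemLp (fun ω => Z ω i) 2 P)
    (A : Matrix (Fin f) (Fin d) ℝ) :
    covMat P (fun ω => A *ᵥ X ω) Z = A * covMat P X Z := by
  ext i j
  simp only [covMat, Matrix.of_apply, Matrix.mul_apply, Matrix.mulVec, dotProduct]
  rw [covariance_fun_sum_left (fun k => (hX k).const_mul _) (hZ j)]
  simp [covariance_const_mul_left]

theorem covMat_add_right [IsFiniteMeasure P] {X Y : Ω → Fin d → ℝ} {Z : Ω → Fin e → ℝ}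
    (hX : ∀ i, MemLp (fun ω => X ω i) 2 P) (hY : ∀ i, MemLp (fun ω => Y ω i) 2 P)
    (hZ : ∀ i, MemLp (fun ω => Z ω i) 2 P) :
    covMat P Z (fun ω => X ω + Y ω) = covMat P Z X + covMat P Z Y := by
  ext i j; exact covariance_add_right (hZ i) (hX j) (hY j)

theorem covMat_sub_right [IsFiniteMeasure P] {X Y : Ω → Fin d → ℝ} {Z : Ω → Fin e → ℝ}
    (hX : ∀ i, MemLp (fun ω => X ω i) 2 P) (hY : ∀ i, MemLp (fun ω => Y ω i) 2 P)
    (hZ : ∀ i, MemLp (fun ω => Z ω i) 2 P) :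
    covMat P Z (fun ω => X ω - Y ω) = covMat P Z X - covMat P Z Y := by
  ext i j; exact covariance_sub_right (hZ i) (hX j) (hY j)

theorem covMat_mulVec_right [IsFiniteMeasure P] {X : Ω → Fin d → ℝ} {Z : Ω → Fin e → ℝ}
    (hX : ∀ i, MemLp (fun ω => X ω i) 2 P) (hZ : ∀ i, MemLp (fun ω => Z ω i) 2 P)
    (A : Matrix (Fin f) (Fin d) ℝ) :
    covMat P Z (fun ω => A *ᵥ X ω) = covMat P Z X * Aᵀ := by
  rw [← covMat_transpose, covMat_mulVec_left hX hZ, Matrix.transpose_mul, covMat_transpose]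

theorem memLp_mulVec {X : Ω → Fin d → ℝ} (hX : ∀ i, MemLp (fun ω => X ω i) 2 P)
    (A : Matrix (Fin f) (Fin d) ℝ) (i : Fin f) : MemLp (fun ω => (A *ᵥ X ω) i) 2 P := by
  simp only [Matrix.mulVec, dotProduct]
  exact memLp_finsetSum _ fun j _ => (hX j).const_mul _

/-- A random vector with vanishing covariance is uncorrelated with everything. -/
theorem covMat_eq_zero_of_self [IsFiniteMeasure P] {X : Ω → Fin d → ℝ} {Y : Ω → Fin e → ℝ}
    (hY : ∀ i, MemLp (fun ω => Y ω i) 2 P) (h : covMat P Y Y = 0) : covMat P X Y = 0 := by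
  ext i j
  have hv : Var[fun ω => Y ω j; P] = 0 := by
    rw [← covariance_self (hY j).aestronglyMeasurable.aemeasurable]
    exact congrFun (congrFun h j) j
  have hev : evariance (fun ω => Y ω j) P = 0 := by
    rw [← (hY j).ofReal_variance_eq, hv, ENNReal.ofReal_zero]
  -- Zero variance makes the coordinate almost surely equal to its mean, so the covariance integrand
  -- vanishes.
  have hae := (evariance_eq_zero_iff (hY j).aestronglyMeasurable.aemeasurable).1 hev
  simp only [covMat, Matrix.of_apply, covariance, Matrix.zero_apply]
  refine integral_eq_zero_of_ae ?_
  filter_upwards [hae] with ω hω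
  simp [hω]

theorem mul_symmPinv_mul_self (S : Matrix (Fin d) (Fin d) ℝ) (hS : S.IsSymm) :
    S * symmPinv S * S = S := by
  have hsa : IsSelfAdjoint S := by
    change star S = S
    rw [Matrix.star_eq_conjTranspose, Matrix.conjTranspose_eq_transpose_of_trivial]
    exact hS
  -- On a finite spectrum every function is continuous, including x ↦ x⁻¹ at 0. The claim becomes x
  -- · x⁻¹ · x = x, which also holds at 0 because 0⁻¹ = 0.
  have hfin : (spectrum ℝ S).Finite := Matrix.finite_real_spectrum
  have hc : ∀ f : ℝ → ℝ, ContinuousOn f (spectrum ℝ S) := fun f => hfin.continuousOn f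
  conv_rhs => rw [← cfc_id ℝ S hsa]
  rw [symmPinv]
  conv_lhs =>
    enter [1, 1]
    rw [← cfc_id ℝ S hsa]
  conv_lhs =>
    enter [2]
    rw [← cfc_id ℝ S hsa]
  rw [← cfc_mul _ _ S (hc _) (hc _), ← cfc_mul _ _ S (hc _) (hc _)]
  congr 1
  ext x
  simp [mul_inv_mul_cancel]

/-- Orthogonality of the linear least-squares residual, also for a singular covariance. -/
theorem covMat_mul_symmPinv_mul [IsFiniteMeasure P] {X : Ω → Fin d → ℝ} {Y : Ω → Fin e → ℝ}
    (hX : ∀ i, MemLp (fun ω => X ω i) 2 P) (hY : ∀ i, MemLp (fun ω => Y ω i) 2 P) :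
    covMat P X Y * symmPinv (covMat P Y Y) * covMat P Y Y = covMat P X Y := by
  set S := covMat P Y Y with hS
  have hsym : S.IsSymm := covMat_transpose Y Y
  -- `N` projects onto the kernel of `S`. The vector Nᵀ Y has zero covariance, hence is uncorrelated
  -- with X, which says cov(X, Y) N = 0: the claim rearranged.
  set N : Matrix (Fin e) (Fin e) ℝ := 1 - symmPinv S * S with hN
  have hSN : S * N = 0 := by
    rw [hN, Matrix.mul_sub, ← Matrix.mul_assoc, mul_symmPinv_mul_self S hsym, Matrix.mul_one,
      sub_self]
  have hNY := memLp_mulVec hY Nᵀ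
  have h0 : covMat P (fun ω => Nᵀ *ᵥ Y ω) (fun ω => Nᵀ *ᵥ Y ω) = 0 := by
    rw [covMat_mulVec_left hY hNY, covMat_mulVec_right hY hY, Matrix.transpose_transpose, ← hS,
      hSN, Matrix.mul_zero]
  have h1 := covMat_eq_zero_of_self (X := X) hNY h0
  rw [covMat_mulVec_right hY hX, Matrix.transpose_transpose, hN, Matrix.mul_sub, Matrix.mul_one,
    sub_eq_zero, ← Matrix.mul_assoc] at h1
  exact h1.symm

end Covariance

/-! ### Linear functions of the primitive Gaussian vectors -/

section GaussianSpan

variable {Ω : Type*} {n m : ℕ}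

/-- The position of a primitive vector in the order `x₀, r₀, w₀, r₁, w₁, …` of their use. -/
def Source.time : Source → ℕ
  | .init => 0
  | .obs t => 2 * t + 1
  | .proc t => 2 * t + 2

/-- The space of random variables that are linear in the primitive vectors up to position `t`. -/
def pastSpan (x₀ : Ω → Fin n → ℝ) (w : ℕ → Ω → Fin n → ℝ) (r : ℕ → Ω → Fin m → ℝ) (t : ℕ) :
    Submodule ℝ (Ω → ℝ) :=
  Submodule.span ℝ {X | ∃ (k : Source) (i : Fin (k.dim n m)),
    k.time ≤ t ∧ X = fun ω => primitive x₀ w r k ω i}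

variable {x₀ : Ω → Fin n → ℝ} {w : ℕ → Ω → Fin n → ℝ} {r : ℕ → Ω → Fin m → ℝ}

theorem coordsIn_primitive (k : Source) {t : ℕ} (h : k.time ≤ t) :
    CoordsIn (pastSpan x₀ w r t) (primitive x₀ w r k) :=
  fun i => Submodule.subset_span ⟨k, i, h, rfl⟩

theorem pastSpan_mono : Monotone (pastSpan x₀ w r) := fun _ _ h =>
  Submodule.span_mono fun _ ⟨k, i, hk, hX⟩ => ⟨k, i, hk.trans h, hX⟩

variable [MeasurableSpace Ω] {P : Measure Ω} {Sig₀ W : Matrix (Fin n) (Fin n) ℝ}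
  {R : Matrix (Fin m) (Fin m) ℝ}

theorem IsGaussianSource.hasGaussianLaw_primitive (h : IsGaussianSource P Sig₀ W R x₀ w r)
    (k : Source) : HasGaussianLaw (primitive x₀ w r k) P := by
  cases k with
  | init => exact h.init.gaussian
  | proc t => exact (h.proc t).gaussian
  | obs t => exact (h.obs t).gaussian

theorem IsGaussianSource.isGaussianProcess_primitive (h : IsGaussianSource P Sig₀ W R x₀ w r) :
    IsGaussianProcess
      (fun (p : (k : Source) × Fin (k.dim n m)) ω => primitive x₀ w r p.1 ω p.2) P where
  hasGaussianLaw I := by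
    classical
    -- Finitely many coordinates involve finitely many sources; these are independent Gaussians,
    -- hence jointly Gaussian, and the coordinates are a linear image of them.
    let J : Finset Source := I.image Sigma.fst
    have hind : iIndepFun (fun k : J => primitive x₀ w r k) P :=
      h.indep.precomp Subtype.val_injective
    have hg := iIndepFun.hasGaussianLaw (X := fun k : J => primitive x₀ w r k)
      (fun k => h.hasGaussianLaw_primitive k) hind
    let L : ((k : J) → Fin ((k : Source).dim n m) → ℝ) →L[ℝ] (I → ℝ) :=
      ContinuousLinearMap.pi fun p =>
        (ContinuousLinearMap.proj (R := ℝ) (φ := fun _ => ℝ) p.1.2).comp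
          (ContinuousLinearMap.proj (R := ℝ)
            (φ := fun k : J => Fin ((k : Source).dim n m) → ℝ)
            ⟨p.1.1, Finset.mem_image_of_mem _ p.2⟩)
    exact hg.map L

/-- Each member is a finite linear combination of primitive coordinates, and linear images of a
Gaussian process are Gaussian. This makes joint Gaussianity of states, observations and estimates a
matter of span membership. -/
theorem IsGaussianSource.isGaussianProcess_of_mem (h : IsGaussianSource P Sig₀ W R x₀ w r)
    {ι : Type*} {t : ℕ} (Y : ι → Ω → ℝ) (hY : ∀ i, Y i ∈ pastSpan x₀ w r t) :
    IsGaussianProcess Y P := by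
  have hprim := h.isGaussianProcess_primitive
  refine hprim.of_isGaussianProcess fun s => ?_
  have hs : Y s ∈ Submodule.span ℝ (Set.range
      (fun (p : (k : Source) × Fin (k.dim n m)) ω => primitive x₀ w r p.1 ω p.2)) := by
    refine Submodule.span_mono ?_ (hY s)
    rintro X ⟨k, i, -, rfl⟩
    exact ⟨⟨k, i⟩, rfl⟩
  obtain ⟨c, hc⟩ := (Finsupp.mem_span_range_iff_exists_finsupp).1 hs
  refine ⟨c.support, ∑ p : c.support, c p • ContinuousLinearMap.proj (R := ℝ)
    (φ := fun _ : c.support => ℝ) p, fun ω => ?_⟩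
  rw [← hc, Finsupp.sum, ← Finset.sum_coe_sort]
  simp

theorem IsGaussianSource.memLp_of_mem (h : IsGaussianSource P Sig₀ W R x₀ w r) {t : ℕ}
    {X : Ω → ℝ} (hX : X ∈ pastSpan x₀ w r t) : MemLp X 2 P :=
  ((h.isGaussianProcess_of_mem (fun _ : Unit => X) fun _ => hX).hasGaussianLaw_eval ()).memLp_two

theorem IsGaussianSource.memLp_coords (h : IsGaussianSource P Sig₀ W R x₀ w r) {t d : ℕ}
    {X : Ω → Fin d → ℝ} (hX : CoordsIn (pastSpan x₀ w r t) X) (i : Fin d) :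
    MemLp (fun ω => X ω i) 2 P :=
  h.memLp_of_mem (hX i)

/-- Linear functions of the past are uncorrelated with the later noises. -/
theorem IsGaussianSource.covMat_primitive_eq_zero [IsProbabilityMeasure P]
    (h : IsGaussianSource P Sig₀ W R x₀ w r) {t d : ℕ} {X : Ω → Fin d → ℝ}
    (hX : CoordsIn (pastSpan x₀ w r t) X) {k : Source} (hk : t < k.time) :
    covMat P X (primitive x₀ w r k) = 0 := by
  ext i j
  have hk2 : MemLp (fun ω => primitive x₀ w r k ω j) 2 P :=
    h.memLp_coords (coordsIn_primitive k le_rfl) j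
  change cov[fun ω => X ω i, fun ω => primitive x₀ w r k ω j; P] = 0
  -- Covariance is linear in `Z`, so it suffices to treat generators, which come from sources other
  -- than `k` and are therefore independent of it.
  suffices ∀ Z ∈ pastSpan x₀ w r t, cov[Z, fun ω => primitive x₀ w r k ω j; P] = 0 from
    this _ (hX i)
  intro Z hZ
  induction hZ using Submodule.span_induction with
  | mem Z hZ =>
    obtain ⟨l, i, hl, rfl⟩ := hZ
    have hlk : l ≠ k := by rintro rfl; omega
    have := (h.indep.indepFun hlk).comp (measurable_pi_apply i) (measurable_pi_apply j)
    exact this.covariance_eq_zero (h.memLp_coords (coordsIn_primitive l le_rfl) i) hk2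
  | zero => simp
  | add Y Z hY hZ ihY ihZ =>
    rw [covariance_add_left (h.memLp_of_mem hY) (h.memLp_of_mem hZ) hk2, ihY, ihZ, add_zero]
  | smul c Z _ ih => rw [covariance_smul_left, ih, mul_zero]

theorem IsCenteredGaussian.covMat_self [IsProbabilityMeasure P] {d : ℕ} {X : Ω → Fin d → ℝ}
    {S : Matrix (Fin d) (Fin d) ℝ} (h : IsCenteredGaussian P X S) : covMat P X X = S := by
  ext i j
  have hL : ∀ i, MemLp (fun ω => X ω i) 2 P := fun i => (h.gaussian.eval i).memLp_two
  rw [covMat, Matrix.of_apply, covariance_eq_sub (hL i) (hL j), h.mean_eq_zero i, zero_mul,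
    sub_zero, ← h.second_moment i j]
  rfl

/-- Uncorrelated vectors in the span of the primitive vectors are independent. -/
theorem IsGaussianSource.indepFun_of_covMat_eq_zero (h : IsGaussianSource P Sig₀ W R x₀ w r)
    {t d e : ℕ} {ι : Type*} [Finite ι] {X : Ω → Fin d → ℝ} {Y : ι → Ω → Fin e → ℝ}
    (hX : CoordsIn (pastSpan x₀ w r t) X) (hY : ∀ s, CoordsIn (pastSpan x₀ w r t) (Y s))
    (hXY : ∀ s, covMat P X (Y s) = 0) :
    IndepFun X (fun ω s => Y s ω) P := by
  -- Independence from zero covariance needs X and all the Y's to be jointly Gaussian, so they are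
  -- put into one process.
  have hproc : IsGaussianProcess (Sum.elim (fun i ω => X ω i)
      (fun (p : ι × Fin e) ω => Y p.1 ω p.2)) P := by
    refine h.isGaussianProcess_of_mem (t := t) _ ?_
    rintro (i | p)
    · exact hX i
    · exact hY p.1 p.2
  have hind := hproc.indepFun_of_covariance_eq_zero
    (fun i => (h.memLp_of_mem (hX i)).aestronglyMeasurable.aemeasurable)
    (fun p => (h.memLp_of_mem (hY p.1 p.2)).aestronglyMeasurable.aemeasurable)
    (fun i p => congrFun (congrFun (hXY p.1) i) p.2)
  exact hind.comp measurable_id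
    (ψ := fun (z : ι × Fin e → ℝ) s j => z (s, j)) (by fun_prop)

end GaussianSpan

/-! ### The Kalman filter: orthogonality, error covariance, independence -/

section Kalman

variable {Ω : Type*} {n m : ℕ} (A : Matrix (Fin n) (Fin n) ℝ) (C : Matrix (Fin m) (Fin n) ℝ)
  (Sig₀ W : Matrix (Fin n) (Fin n) ℝ) (R : Matrix (Fin m) (Fin m) ℝ)
  (x₀ : Ω → Fin n → ℝ) (w : ℕ → Ω → Fin n → ℝ) (r : ℕ → Ω → Fin m → ℝ)

/-- The Kalman filter estimate along the observations. -/
noncomputable def filterMean (t : ℕ) (ω : Ω) : Fin n → ℝ :=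
  kalmanMean A C Sig₀ W R t fun s : Fin (t + 1) => observation A C x₀ w r s ω

/-- The prediction of `x_t` from `y_0, …, y_{t-1}`. -/
noncomputable def predMean : ℕ → Ω → Fin n → ℝ
  | 0 => fun _ => 0
  | t + 1 => fun ω => A *ᵥ filterMean A C Sig₀ W R x₀ w r t ω

/-- The innovation `y_t - C A m̃_{t-1}`. -/
noncomputable def innovation (t : ℕ) (ω : Ω) : Fin m → ℝ :=
  observation A C x₀ w r t ω - C *ᵥ predMean A C Sig₀ W R x₀ w r t ω

theorem filterMean_eq (t : ℕ) (ω : Ω) :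
    filterMean A C Sig₀ W R x₀ w r t ω = predMean A C Sig₀ W R x₀ w r t ω +
      kalmanGain C R (predCov A C Sig₀ W R t) *ᵥ innovation A C Sig₀ W R x₀ w r t ω := by
  cases t with
  | zero => simp [filterMean, predMean, innovation, kalmanMean]
  | succ t => rfl

variable {A C Sig₀ W R x₀ w r}

/-- The last noise entering the state at time t is w at t - 1, in position 2t; the observation adds
r at t, in position 2t + 1. Later noises are thus strictly beyond these positions. -/
theorem coordsIn_state (t : ℕ) : CoordsIn (pastSpan x₀ w r (2 * t)) (state A x₀ w t) := by
  induction t with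
  | zero => exact coordsIn_primitive .init le_rfl
  | succ t ih =>
    exact ((ih.mono (pastSpan_mono (by omega))).mulVec A).add
      (coordsIn_primitive (.proc t) le_rfl)

theorem coordsIn_observation (t : ℕ) :
    CoordsIn (pastSpan x₀ w r (2 * t + 1)) (observation A C x₀ w r t) :=
  (((coordsIn_state t).mono (pastSpan_mono (by omega))).mulVec C).add
    (coordsIn_primitive (.obs t) le_rfl)

theorem coordsIn_predMean_filterMean (t : ℕ) :
    CoordsIn (pastSpan x₀ w r (2 * t)) (predMean A C Sig₀ W R x₀ w r t) ∧
      CoordsIn (pastSpan x₀ w r (2 * t + 1)) (filterMean A C Sig₀ W R x₀ w r t) := by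
  have key : ∀ t, CoordsIn (pastSpan x₀ w r (2 * t)) (predMean A C Sig₀ W R x₀ w r t) →
      CoordsIn (pastSpan x₀ w r (2 * t + 1)) (filterMean A C Sig₀ W R x₀ w r t) := by
    intro t ht
    have ht' : CoordsIn (pastSpan x₀ w r (2 * t + 1)) (predMean A C Sig₀ W R x₀ w r t) :=
      ht.mono (pastSpan_mono (Nat.le_succ _))
    have he : CoordsIn (pastSpan x₀ w r (2 * t + 1)) (innovation A C Sig₀ W R x₀ w r t) :=
      (coordsIn_observation t).sub (ht'.mulVec C)
    have := ht'.add (he.mulVec (kalmanGain C R (predCov A C Sig₀ W R t)))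
    rwa [show filterMean A C Sig₀ W R x₀ w r t = _ from
      funext (filterMean_eq A C Sig₀ W R x₀ w r t)]
  induction t with
  | zero =>
    have h0 : CoordsIn (pastSpan x₀ w r 0) (predMean A C Sig₀ W R x₀ w r 0) :=
      fun i => (pastSpan x₀ w r 0).zero_mem
    exact ⟨h0, key 0 h0⟩
  | succ t ih =>
    have h1 : CoordsIn (pastSpan x₀ w r (2 * (t + 1))) (predMean A C Sig₀ W R x₀ w r (t + 1)) :=
      (ih.2.mono (pastSpan_mono (by omega))).mulVec A
    exact ⟨h1, key _ h1⟩

theorem coordsIn_innovation (t : ℕ) :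
    CoordsIn (pastSpan x₀ w r (2 * t + 1)) (innovation A C Sig₀ W R x₀ w r t) :=
  (coordsIn_observation t).sub
    (((coordsIn_predMean_filterMean t).1.mono (pastSpan_mono (by omega))).mulVec C)

variable [MeasurableSpace Ω] {P : Measure Ω}

/-- Whatever is uncorrelated with `y_0, …, y_{t-1}` is uncorrelated with the prediction. -/
theorem IsGaussianSource.covMat_predMean_eq_zero [IsProbabilityMeasure P]
    (h : IsGaussianSource P Sig₀ W R x₀ w r) {d T : ℕ} {X : Ω → Fin d → ℝ}
    (hX : CoordsIn (pastSpan x₀ w r T) X) (t : ℕ)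
    (hXY : ∀ s < t, covMat P X (observation A C x₀ w r s) = 0) :
    covMat P X (predMean A C Sig₀ W R x₀ w r t) = 0 := by
  have hX2 := h.memLp_coords hX
  induction t with
  | zero => ext i j; exact covariance_zero_right
  | succ t ih =>
    have hp := ih fun s hs => hXY s (hs.trans t.lt_succ_self)
    have hy := hXY t t.lt_succ_self
    have hp2 := h.memLp_coords (coordsIn_predMean_filterMean (A := A) (C := C) (Sig₀ := Sig₀)
      (W := W) (R := R) (x₀ := x₀) (w := w) (r := r) t).1
    have hf2 := h.memLp_coords (coordsIn_predMean_filterMean (A := A) (C := C) (Sig₀ := Sig₀)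
      (W := W) (R := R) (x₀ := x₀) (w := w) (r := r) t).2
    have hy2 := h.memLp_coords (coordsIn_observation (A := A) (C := C) (x₀ := x₀) (w := w)
      (r := r) t)
    have he2 := h.memLp_coords (coordsIn_innovation (A := A) (C := C) (Sig₀ := Sig₀)
      (W := W) (R := R) (x₀ := x₀) (w := w) (r := r) t)
    have he : covMat P X (innovation A C Sig₀ W R x₀ w r t) = 0 := by
      have := covMat_sub_right (P := P) hy2 (memLp_mulVec hp2 C) hX2
      rw [covMat_mulVec_right hp2 hX2, hp, hy, Matrix.zero_mul, sub_zero] at this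
      exact this
    have hf : covMat P X (filterMean A C Sig₀ W R x₀ w r t) = 0 := by
      rw [show filterMean A C Sig₀ W R x₀ w r t = _ from
        funext (filterMean_eq A C Sig₀ W R x₀ w r t),
        covMat_add_right hp2 (memLp_mulVec he2 _) hX2, covMat_mulVec_right he2 hX2, hp, he,
        Matrix.zero_mul, add_zero]
    exact (covMat_mulVec_right hf2 hX2 A).trans (by rw [hf, Matrix.zero_mul])

/-- The Kalman filter: the prediction error has covariance `Σ_{t|t-1}` and is uncorrelated with the
earlier observations, and the filter error is uncorrelated with the observations so far. -/
theorem IsGaussianSource.kalman [IsProbabilityMeasure P]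
    (h : IsGaussianSource P Sig₀ W R x₀ w r) (t : ℕ) :
    (covMat P (fun ω => state A x₀ w t ω - predMean A C Sig₀ W R x₀ w r t ω)
        (fun ω => state A x₀ w t ω - predMean A C Sig₀ W R x₀ w r t ω) = predCov A C Sig₀ W R t ∧
      ∀ s < t, covMat P (fun ω => state A x₀ w t ω - predMean A C Sig₀ W R x₀ w r t ω)
        (observation A C x₀ w r s) = 0) ∧
    (∀ s < t, covMat P (innovation A C Sig₀ W R x₀ w r t) (observation A C x₀ w r s) = 0) ∧
    (∀ s ≤ t, covMat P (fun ω => state A x₀ w t ω - filterMean A C Sig₀ W R x₀ w r t ω)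
        (observation A C x₀ w r s) = 0) := by
  -- Measurement update. The covariance of the filter error is carried along because the Riccati
  -- step of the induction below needs it.
  have key : ∀ t, (covMat P (fun ω => state A x₀ w t ω - predMean A C Sig₀ W R x₀ w r t ω)
        (fun ω => state A x₀ w t ω - predMean A C Sig₀ W R x₀ w r t ω) = predCov A C Sig₀ W R t ∧
      ∀ s < t, covMat P (fun ω => state A x₀ w t ω - predMean A C Sig₀ W R x₀ w r t ω)
        (observation A C x₀ w r s) = 0) →
    (∀ s < t, covMat P (innovation A C Sig₀ W R x₀ w r t) (observation A C x₀ w r s) = 0) ∧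
    (∀ s ≤ t, covMat P (fun ω => state A x₀ w t ω - filterMean A C Sig₀ W R x₀ w r t ω)
        (observation A C x₀ w r s) = 0) ∧
    covMat P (fun ω => state A x₀ w t ω - filterMean A C Sig₀ W R x₀ w r t ω)
        (fun ω => state A x₀ w t ω - filterMean A C Sig₀ W R x₀ w r t ω) =
      predCov A C Sig₀ W R t - kalmanGain C R (predCov A C Sig₀ W R t) *
        (C * predCov A C Sig₀ W R t) := by
    intro t ⟨hcov, horth⟩
    set S := predCov A C Sig₀ W R t with hS
    set K := kalmanGain C R S with hK
    set ξ : Ω → Fin n → ℝ := fun ω => state A x₀ w t ω - predMean A C Sig₀ W R x₀ w r t ω with hξ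
    set e := innovation A C Sig₀ W R x₀ w r t with he
    have hpL := (coordsIn_predMean_filterMean (A := A) (C := C) (Sig₀ := Sig₀)
      (W := W) (R := R) (x₀ := x₀) (w := w) (r := r) t).1
    have hξL : CoordsIn (pastSpan x₀ w r (2 * t)) ξ := (coordsIn_state t).sub hpL
    have hp2 := h.memLp_coords hpL
    have hξ2 := h.memLp_coords hξL
    have hr2 : ∀ i, MemLp (fun ω => r t ω i) 2 P :=
      h.memLp_coords (coordsIn_primitive (x₀ := x₀) (w := w) (r := r) (.obs t) le_rfl)
    have he_eq : e = fun ω => C *ᵥ ξ ω + r t ω := by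
      funext ω
      simp only [he, hξ, innovation, observation, Matrix.mulVec_sub]
      abel
    have he2 : ∀ i, MemLp (fun ω => e ω i) 2 P := h.memLp_coords (coordsIn_innovation t)
    have hξr : covMat P ξ (r t) = 0 := h.covMat_primitive_eq_zero hξL (k := .obs t)
      (Nat.lt_succ_self (2 * t))
    have hξe : covMat P ξ e = S * Cᵀ := by
      rw [he_eq, covMat_add_right (memLp_mulVec hξ2 C) hr2 hξ2, covMat_mulVec_right hξ2 hξ2,
        hcov, hξr, add_zero]
    have hee : covMat P e e = C * S * Cᵀ + R := by
      have hre : covMat P (r t) e = R := by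
        have h1 : covMat P (r t) ξ = 0 := by rw [← covMat_transpose, hξr, Matrix.transpose_zero]
        rw [he_eq, covMat_add_right (memLp_mulVec hξ2 C) hr2 hr2, covMat_mulVec_right hξ2 hr2,
          h1, (h.obs t).covMat_self, Matrix.zero_mul, zero_add]
      conv_lhs => enter [2]; rw [he_eq]
      rw [covMat_add_left (memLp_mulVec hξ2 C) hr2 he2, covMat_mulVec_left hξ2 he2, hξe, hre,
        Matrix.mul_assoc]
    set z : Ω → Fin n → ℝ := fun ω => state A x₀ w t ω - filterMean A C Sig₀ W R x₀ w r t ω with hz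
    have hz_eq : z = fun ω => ξ ω - K *ᵥ e ω := by
      funext ω
      simp only [hz, hξ, filterMean_eq]
      abel
    -- The gain is exactly the least-squares coefficient cov(ξ, e) cov(e, e)⁺, so the residual is
    -- orthogonal to the innovation.
    have hze : covMat P z e = 0 := by
      have := covMat_mul_symmPinv_mul hξ2 he2
      rw [hz_eq, covMat_sub_left hξ2 (memLp_mulVec he2 K) he2, covMat_mulVec_left he2 he2,
        hK, kalmanGain, ← hee, ← hξe, this, sub_self]
    have hz2 : ∀ i, MemLp (fun ω => z ω i) 2 P := by
      rw [hz_eq]; exact fun i => (hξ2 i).sub (memLp_mulVec he2 K i)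
    have heobs : ∀ s < t, covMat P e (observation A C x₀ w r s) = 0 := by
      intro s hs
      have hyL : CoordsIn (pastSpan x₀ w r (2 * t)) (observation A C x₀ w r s) :=
        (coordsIn_observation s).mono (pastSpan_mono (by omega))
      have hy2 := h.memLp_coords hyL
      have hry : covMat P (r t) (observation A C x₀ w r s) = 0 := by
        have : covMat P (observation A C x₀ w r s) (r t) = 0 :=
          h.covMat_primitive_eq_zero hyL (k := .obs t) (Nat.lt_succ_self (2 * t))
        rw [← covMat_transpose, this, Matrix.transpose_zero]
      rw [he_eq, covMat_add_left (memLp_mulVec hξ2 C) hr2 hy2, covMat_mulVec_left hξ2 hy2,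
        horth s hs, hry, Matrix.mul_zero, zero_add]
    have hzobs' : ∀ s < t, covMat P z (observation A C x₀ w r s) = 0 := by
      intro s hs
      have hy2 := h.memLp_coords (coordsIn_observation (A := A) (C := C) (x₀ := x₀) (w := w)
        (r := r) s)
      rw [hz_eq, covMat_sub_left hξ2 (memLp_mulVec he2 K) hy2, covMat_mulVec_left he2 hy2,
        horth s hs, heobs s hs, Matrix.mul_zero, sub_zero]
    have hzL : CoordsIn (pastSpan x₀ w r (2 * t + 1)) z :=
      ((coordsIn_state t).mono (pastSpan_mono (by omega))).sub (coordsIn_predMean_filterMean t).2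
    refine ⟨heobs, fun s hs => ?_, ?_⟩
    · rcases hs.lt_or_eq with hs | rfl
      · exact hzobs' s hs
      -- The newest observation is the innovation plus a prediction built from earlier observations,
      -- and the filter error is uncorrelated with both.
      · have hy : observation A C x₀ w r s = fun ω => e ω +
            C *ᵥ predMean A C Sig₀ W R x₀ w r s ω := by
          funext ω; simp [he, innovation]
        rw [hy, covMat_add_right he2 (memLp_mulVec hp2 C) hz2, covMat_mulVec_right hp2 hz2, hze,
          h.covMat_predMean_eq_zero hzL s hzobs', Matrix.zero_mul, zero_add]
    · have hzξ : covMat P z ξ = S - K * (C * S) := by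
        have hSs : Sᵀ = S := by rw [← hcov, covMat_transpose]
        have heξ : covMat P e ξ = C * S := by
          rw [← covMat_transpose, hξe, Matrix.transpose_mul, Matrix.transpose_transpose, hSs]
        rw [hz_eq, covMat_sub_left hξ2 (memLp_mulVec he2 K) hξ2, covMat_mulVec_left he2 hξ2,
          hcov, heξ]
      -- Only the right argument is expanded: orthogonality to `e` leaves cov(z, ξ).
      conv_lhs => enter [3]; rw [hz_eq]
      rw [covMat_sub_right hξ2 (memLp_mulVec he2 K) hz2, covMat_mulVec_right he2 hz2, hze, hzξ,
        Matrix.zero_mul, sub_zero]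
  suffices hmain : (covMat P (fun ω => state A x₀ w t ω - predMean A C Sig₀ W R x₀ w r t ω)
        (fun ω => state A x₀ w t ω - predMean A C Sig₀ W R x₀ w r t ω) = predCov A C Sig₀ W R t ∧
      ∀ s < t, covMat P (fun ω => state A x₀ w t ω - predMean A C Sig₀ W R x₀ w r t ω)
        (observation A C x₀ w r s) = 0) from
    ⟨hmain, (key t hmain).1, (key t hmain).2.1⟩
  induction t with
  | zero =>
    refine ⟨?_, fun s hs => absurd hs (Nat.not_lt_zero s)⟩
    simp only [predMean, sub_zero, state, predCov]
    exact h.init.covMat_self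
  | succ t ih =>
    obtain ⟨-, hzy, hzz⟩ := key t ih
    set z : Ω → Fin n → ℝ := fun ω => state A x₀ w t ω - filterMean A C Sig₀ W R x₀ w r t ω with hz
    -- Time update: the new prediction error is the propagated filter error plus a fresh process
    -- noise.
    have hξ : (fun ω => state A x₀ w (t + 1) ω - predMean A C Sig₀ W R x₀ w r (t + 1) ω) =
        fun ω => A *ᵥ z ω + w t ω := by
      funext ω
      simp only [state, predMean, hz, Matrix.mulVec_sub]
      abel
    have hzL : CoordsIn (pastSpan x₀ w r (2 * t + 1)) z :=
      ((coordsIn_state t).mono (pastSpan_mono (by omega))).sub (coordsIn_predMean_filterMean t).2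
    have hz2 := h.memLp_coords hzL
    have hw2 : ∀ i, MemLp (fun ω => w t ω i) 2 P :=
      h.memLp_coords (coordsIn_primitive (x₀ := x₀) (w := w) (r := r) (.proc t) le_rfl)
    have hAz2 := memLp_mulVec hz2 A
    have hξ2 : ∀ i, MemLp (fun ω => (A *ᵥ z ω + w t ω) i) 2 P := fun i => (hAz2 i).add (hw2 i)
    rw [hξ]
    constructor
    · have hzw : covMat P z (w t) = 0 :=
        h.covMat_primitive_eq_zero hzL (k := .proc t) (Nat.lt_succ_self (2 * t + 1))
      have hwz : covMat P (w t) z = 0 := by rw [← covMat_transpose, hzw, Matrix.transpose_zero]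
      rw [covMat_add_left hAz2 hw2 hξ2, covMat_mulVec_left hz2 hξ2,
        covMat_add_right hAz2 hw2 hz2, covMat_add_right hAz2 hw2 hw2,
        covMat_mulVec_right hz2 hz2, covMat_mulVec_right hz2 hw2, hzw, hwz, hzz,
        (h.proc t).covMat_self, predCov, kalmanGain]
      simp only [Matrix.zero_mul, add_zero, zero_add, Matrix.mul_sub, Matrix.sub_mul,
        Matrix.mul_assoc]
      abel
    · intro s hs
      have hyL := coordsIn_observation (A := A) (C := C) (x₀ := x₀) (w := w) (r := r) s
      have hy2 := h.memLp_coords hyL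
      have hyw : covMat P (observation A C x₀ w r s) (w t) = 0 :=
        h.covMat_primitive_eq_zero hyL (k := .proc t) (by simp only [Source.time]; omega)
      have hwy : covMat P (w t) (observation A C x₀ w r s) = 0 := by
        rw [← covMat_transpose, hyw, Matrix.transpose_zero]
      rw [covMat_add_left hAz2 hw2 hy2, covMat_mulVec_left hz2 hy2, hzy s (Nat.lt_succ_iff.1 hs),
        hwy, Matrix.mul_zero, add_zero]

/-- Zero covariance upgrades to independence by joint Gaussianity. The error can then be integrated
out with the observations, and so any symbols computed from them, held fixed. -/
theorem IsGaussianSource.indepFun_filterError [IsProbabilityMeasure P]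
    (h : IsGaussianSource P Sig₀ W R x₀ w r) (t : ℕ) :
    IndepFun (fun ω => state A x₀ w t ω - filterMean A C Sig₀ W R x₀ w r t ω)
      (fun ω (s : Fin (t + 1)) => observation A C x₀ w r s ω) P :=
  h.indepFun_of_covMat_eq_zero (t := 2 * t + 1)
    (((coordsIn_state t).mono (pastSpan_mono (by omega))).sub (coordsIn_predMean_filterMean t).2)
    (fun s => (coordsIn_observation s).mono (pastSpan_mono (by have := s.2; omega)))
    (fun s => (h.kalman t).2.2 s (Nat.lt_succ_iff.1 s.2))

/-- The innovation acts as the fresh noise driving the filter mean; it is independent of everything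
the encoder has used up to time t. -/
theorem IsGaussianSource.indepFun_innovation [IsProbabilityMeasure P]
    (h : IsGaussianSource P Sig₀ W R x₀ w r) (t : ℕ) :
    IndepFun (innovation A C Sig₀ W R x₀ w r (t + 1))
      (fun ω (s : Fin (t + 1)) => observation A C x₀ w r s ω) P :=
  h.indepFun_of_covMat_eq_zero (t := 2 * (t + 1) + 1) (coordsIn_innovation (t + 1))
    (fun s => (coordsIn_observation s).mono (pastSpan_mono (by have := s.2; omega)))
    (fun s => (h.kalman (t + 1)).2.1 s s.2)

theorem IsGaussianSource.measurable_state (h : IsGaussianSource P Sig₀ W R x₀ w r) (t : ℕ) :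
    Measurable (state A x₀ w t) := by
  induction t with
  | zero => exact h.init.measurable
  | succ t ih =>
    exact ((Continuous.matrix_mulVec continuous_const continuous_id).measurable.comp ih).add
      (h.proc t).measurable

theorem IsGaussianSource.measurable_observation (h : IsGaussianSource P Sig₀ W R x₀ w r)
    (t : ℕ) : Measurable (observation A C x₀ w r t) :=
  ((Continuous.matrix_mulVec continuous_const continuous_id).measurable.comp
    (h.measurable_state t)).add (h.obs t).measurable

theorem continuous_kalmanMean (t : ℕ) : Continuous (kalmanMean A C Sig₀ W R t) := by
  induction t with
  | zero => exact Continuous.matrix_mulVec continuous_const (continuous_apply 0)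
  | succ t ih =>
    have hp : Continuous fun y : Fin (t + 1 + 1) → Fin m → ℝ =>
        A *ᵥ kalmanMean A C Sig₀ W R t (fun s => y s.castSucc) :=
      Continuous.matrix_mulVec continuous_const (ih.comp (by fun_prop))
    exact hp.add (Continuous.matrix_mulVec continuous_const
      ((continuous_apply _).sub (Continuous.matrix_mulVec continuous_const hp)))

theorem IsGaussianSource.measurable_filterMean (h : IsGaussianSource P Sig₀ W R x₀ w r) (t : ℕ) :
    Measurable (filterMean A C Sig₀ W R x₀ w r t) :=
  (continuous_kalmanMean t).measurable.comp
    (measurable_pi_lambda _ fun _ => h.measurable_observation _)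

theorem IsGaussianSource.measurable_innovation (h : IsGaussianSource P Sig₀ W R x₀ w r) (t : ℕ) :
    Measurable (innovation A C Sig₀ W R x₀ w r (t + 1)) :=
  (h.measurable_observation _).sub
    ((Continuous.matrix_mulVec continuous_const continuous_id).measurable.comp
      ((Continuous.matrix_mulVec continuous_const continuous_id).measurable.comp
        (h.measurable_filterMean t)))

end Kalman

/-! ### Quantizer outputs as measurable functions of the observations -/

section History

variable {m n : ℕ} {M : ℕ → ℕ}

/-- The quantizer outputs `q_0, …, q_{t-1}` along an observation sequence. -/
noncomputable def CompositePolicy.history (Q : CompositePolicy m M) (y : ℕ → Fin m → ℝ) (t : ℕ) :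
    History M t :=
  fun s => Q.output y s

/-- Append a symbol to a string of quantizer outputs. -/
def History.snoc {t : ℕ} (h : History M t) (q : Fin (M t)) : History M (t + 1) :=
  Fin.snoc (α := fun s : Fin (t + 1) => Fin (M s)) h q

theorem CompositePolicy.output_eq (Q : CompositePolicy m M) (y : ℕ → Fin m → ℝ) (t : ℕ) :
    Q.output y t = Q.map t (fun s => y s) (Q.history y t) := by
  rw [CompositePolicy.output]
  rfl

theorem CompositePolicy.history_succ (Q : CompositePolicy m M) (y : ℕ → Fin m → ℝ) (t : ℕ) :
    Q.history y (t + 1) = (Q.history y t).snoc (Q.output y t) := by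
  funext s
  refine Fin.lastCases ?_ (fun s => ?_) s
  · simp [CompositePolicy.history, History.snoc]
  · simp [CompositePolicy.history, History.snoc]

/-- The quantizer output is a measurable function of the observations so far. -/
theorem CompositePolicy.exists_output_eq (Q : CompositePolicy m M) (t : ℕ) :
    ∃ φ : (Fin (t + 1) → Fin m → ℝ) → Fin (M t), Measurable φ ∧
      ∀ y : ℕ → Fin m → ℝ, Q.output y t = φ fun s => y s := by
  induction t using Nat.strong_induction_on with
  | _ t ih =>
    choose φ hφ hφy using ih
    refine ⟨fun y => Q.map t y fun s => φ s s.2 fun u => y (Fin.castLE (by omega) u), ?_, ?_⟩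
    · refine (Q.measurable_map t).comp (measurable_id.prodMk (measurable_pi_lambda _ fun s => ?_))
      exact (hφ s s.2).comp (by fun_prop)
    · intro y
      rw [Q.output_eq]
      congr 1
      funext s
      exact hφy s s.2 y

theorem CompositePolicy.exists_history_eq (Q : CompositePolicy m M) (t : ℕ) :
    ∃ φ : (Fin (t + 1) → Fin m → ℝ) → History M (t + 1), Measurable φ ∧
      ∀ y : ℕ → Fin m → ℝ, Q.history y (t + 1) = φ fun s => y s := by
  choose φ hφ hφy using Q.exists_output_eq
  refine ⟨fun y s => φ s fun u => y (Fin.castLE (by omega) u),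
    measurable_pi_lambda _ fun s => (hφ s).comp (by fun_prop), fun y => ?_⟩
  funext s
  exact hφy s y

theorem CompositePolicy.measurable_history {Ω : Type*} [MeasurableSpace Ω]
    (Q : CompositePolicy m M) {y : ℕ → Ω → Fin m → ℝ} (hy : ∀ t, Measurable (y t)) (t : ℕ) :
    Measurable fun ω => Q.history (fun u => y u ω) t := by
  refine measurable_pi_lambda _ fun s => ?_
  obtain ⟨φ, hφ, hφy⟩ := Q.exists_output_eq s
  simp only [CompositePolicy.history, hφy]
  exact hφ.comp (measurable_pi_lambda _ fun u => hy u)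

end History

/-! ### Stage costs and optimal receivers -/

section Receiver

variable {Ω : Type*} [MeasurableSpace Ω] {n m : ℕ} {M : ℕ → ℕ}

/-- The quadratic distortion. -/
noncomputable def quadCost (Qc : Matrix (Fin n) (Fin n) ℝ) (u : Fin n → ℝ) : ℝ≥0∞ :=
  ENNReal.ofReal (u ⬝ᵥ (Qc *ᵥ u))

theorem measurable_quadCost (Qc : Matrix (Fin n) (Fin n) ℝ) : Measurable (quadCost Qc) :=
  ENNReal.measurable_ofReal.comp
    (continuous_id.dotProduct (continuous_const.matrix_mulVec continuous_id)).measurable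

theorem dotProduct_mulVec_self_nonneg {Qc : Matrix (Fin n) (Fin n) ℝ} (hQc : Qc.PosSemidef)
    (u : Fin n → ℝ) : 0 ≤ u ⬝ᵥ (Qc *ᵥ u) := by
  simpa using hQc.dotProduct_mulVec_nonneg u

/-- The expected distortion at time `t`. -/
noncomputable def stageCost (P : Measure Ω) (Qc : Matrix (Fin n) (Fin n) ℝ)
    (x : ℕ → Ω → Fin n → ℝ) (y : ℕ → Ω → Fin m → ℝ) (Q : CompositePolicy m M)
    (g : ReceiverPolicy n M) (t : ℕ) : ℝ≥0∞ :=
  ∫⁻ ω, quadCost Qc (x t ω - g.map t (Q.history (fun u => y u ω) (t + 1))) ∂P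

/-- The expected cost is the sum of the expected distortions. -/
theorem cost_eq_sum {P : Measure Ω} {T : ℕ} {Qc : Matrix (Fin n) (Fin n) ℝ}
    (hQc : Qc.PosSemidef) {x : ℕ → Ω → Fin n → ℝ} {y : ℕ → Ω → Fin m → ℝ}
    (hx : ∀ t, Measurable (x t)) (hy : ∀ t, Measurable (y t))
    (Q : CompositePolicy m M) (g : ReceiverPolicy n M) :
    cost P T Qc x y Q g = ∑ t ∈ Finset.range T, stageCost P Qc x y Q g t := by
  simp only [stageCost]
  rw [← lintegral_finsetSum]
  · refine lintegral_congr fun ω => ?_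
    -- `ENNReal.ofReal` truncates negative values, so it is additive here only because each
    -- distortion is nonnegative.
    exact ENNReal.ofReal_sum_of_nonneg fun t _ => dotProduct_mulVec_self_nonneg hQc _
  · intro t _
    exact (measurable_quadCost Qc).comp
      ((hx t).sub ((g.measurable_map t).comp (Q.measurable_history hy (t + 1))))

/-- The mean is the best constant estimate in mean square. -/
theorem exists_best_constant {ν : Measure Ω} [IsFiniteMeasure ν] {Qc : Matrix (Fin n) (Fin n) ℝ}
    (hQc : Qc.PosSemidef) {X : Ω → Fin n → ℝ} (hX : ∀ i, MemLp (fun ω => X ω i) 2 ν) :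
    ∃ v, ∀ u, ∫⁻ ω, quadCost Qc (X ω - v) ∂ν ≤ ∫⁻ ω, quadCost Qc (X ω - u) ∂ν := by
  rcases eq_or_ne ν 0 with rfl | hν
  · exact ⟨0, fun u => by simp⟩
  have hp : ν.real Set.univ ≠ 0 := by
    simpa [Measure.real, ENNReal.toReal_eq_zero_iff] using hν
  -- The mean is normalized by the total mass, since `ν` will be the restriction of `P` to a fiber.
  set v : Fin n → ℝ := fun i => (ν.real Set.univ)⁻¹ * ∫ ω, X ω i ∂ν with hv
  have hXu : ∀ u : Fin n → ℝ, ∀ i, MemLp (fun ω => (X ω - u) i) 2 ν :=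
    fun u i => (hX i).sub (memLp_const (u i))
  have hint : ∀ u, Integrable (fun ω => (X ω - u) ⬝ᵥ (Qc *ᵥ (X ω - u))) ν := by
    intro u
    simp only [dotProduct]
    exact integrable_finsetSum _ fun i _ =>
      (hXu u i).integrable_mul (memLp_mulVec (hXu u) Qc i)
  have hzero : ∀ i, ∫ ω, (X ω - v) i ∂ν = 0 := by
    intro i
    simp only [Pi.sub_apply]
    rw [integral_sub ((hX i).integrable one_le_two) (integrable_const _), integral_const,
      smul_eq_mul, hv]
    field_simp
    ring
  have hlin : ∀ d : Fin n → ℝ, ∫ ω, (X ω - v) ⬝ᵥ d ∂ν = 0 := by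
    intro d
    simp only [dotProduct]
    rw [integral_finsetSum _ fun i _ => ((hXu v i).integrable one_le_two).mul_const _]
    simp only [integral_mul_const, hzero, zero_mul, Finset.sum_const_zero]
  refine ⟨v, fun u => ?_⟩
  simp only [quadCost]
  rw [← ofReal_integral_eq_lintegral_ofReal (hint v)
      (ae_of_all _ fun ω => dotProduct_mulVec_self_nonneg hQc _),
    ← ofReal_integral_eq_lintegral_ofReal (hint u)
      (ae_of_all _ fun ω => dotProduct_mulVec_self_nonneg hQc _)]
  refine ENNReal.ofReal_le_ofReal ?_
  have hsymm : Qcᵀ = Qc := by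
    simpa [Matrix.conjTranspose_eq_transpose_of_trivial] using hQc.isHermitian.eq
  -- Expansion around the mean: the cross term integrates to zero and the last term is nonnegative.
  have hexp : ∀ ω, (X ω - u) ⬝ᵥ (Qc *ᵥ (X ω - u)) = (X ω - v) ⬝ᵥ (Qc *ᵥ (X ω - v)) +
      (X ω - v) ⬝ᵥ ((2 : ℝ) • (Qc *ᵥ (v - u))) + (v - u) ⬝ᵥ (Qc *ᵥ (v - u)) := by
    intro ω
    have h1 : X ω - u = (X ω - v) + (v - u) := by abel
    have h2 : (v - u) ⬝ᵥ (Qc *ᵥ (X ω - v)) = (X ω - v) ⬝ᵥ (Qc *ᵥ (v - u)) := by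
      rw [Matrix.dotProduct_mulVec, ← Matrix.mulVec_transpose, hsymm, dotProduct_comm]
    rw [h1, Matrix.mulVec_add, dotProduct_add, add_dotProduct, add_dotProduct, h2,
      dotProduct_smul, smul_eq_mul]
    ring
  have hlinint : Integrable (fun ω => (X ω - v) ⬝ᵥ ((2 : ℝ) • (Qc *ᵥ (v - u)))) ν := by
    simp only [dotProduct]
    exact integrable_finsetSum _ fun i _ => ((hXu v i).integrable one_le_two).mul_const _
  rw [integral_congr_ae (ae_of_all _ hexp), integral_add (by exact (hint v).add hlinint)
    (integrable_const _), integral_add (hint v) hlinint, hlin, add_zero]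
  exact le_add_of_nonneg_right
    (integral_nonneg fun _ => dotProduct_mulVec_self_nonneg hQc _)

theorem lintegral_eq_sum_fiber {P : Measure Ω} {ι : Type*} [Fintype ι] [MeasurableSpace ι]
    [MeasurableSingletonClass ι] {H : Ω → ι} (hH : Measurable H) {f : ι → Ω → ℝ≥0∞}
    (hf : ∀ i, Measurable (f i)) :
    ∫⁻ ω, f (H ω) ω ∂P = ∑ i, ∫⁻ ω in H ⁻¹' {i}, f i ω ∂P := by
  classical
  have hm : ∀ i, MeasurableSet (H ⁻¹' {i}) := fun i => hH (measurableSet_singleton i)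
  simp only [← lintegral_indicator (hm _)]
  rw [← lintegral_finsetSum _ fun i _ => (hf i).indicator (hm i)]
  refine lintegral_congr fun ω => ?_
  rw [Finset.sum_eq_single (H ω)]
  · simp
  · intro i _ hi
    exact Set.indicator_of_notMem (fun h => hi h.symm) _
  · simp

/-- For every encoder there is an optimal receiver. -/
theorem exists_optimal_receiver {P : Measure Ω} [IsFiniteMeasure P] {T : ℕ}
    {Qc : Matrix (Fin n) (Fin n) ℝ} (hQc : Qc.PosSemidef) {x : ℕ → Ω → Fin n → ℝ}
    {y : ℕ → Ω → Fin m → ℝ} (hx : ∀ t, Measurable (x t))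
    (hx2 : ∀ t i, MemLp (fun ω => x t ω i) 2 P) (hy : ∀ t, Measurable (y t))
    (Q : CompositePolicy m M) :
    ∃ g : ReceiverPolicy n M, performance P T Qc x y Q = cost P T Qc x y Q g := by
  have hH := fun t => Q.measurable_history hy t
  have hbest : ∀ t (h : History M (t + 1)), ∃ v, ∀ u,
      ∫⁻ ω in (fun ω => Q.history (fun u => y u ω) (t + 1)) ⁻¹' {h}, quadCost Qc (x t ω - v) ∂P ≤
      ∫⁻ ω in (fun ω => Q.history (fun u => y u ω) (t + 1)) ⁻¹' {h}, quadCost Qc (x t ω - u) ∂P :=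
    fun t h => exists_best_constant hQc fun i => (hx2 t i).restrict _
  choose v hv using hbest
  -- Histories form a finite discrete space, so choosing the best constant fiber by fiber gives a
  -- measurable receiver.
  refine ⟨⟨v, fun t => Measurable.of_discrete⟩, le_antisymm (iInf_le _ _) (le_iInf fun g => ?_)⟩
  rw [cost_eq_sum hQc hx hy, cost_eq_sum hQc hx hy]
  refine Finset.sum_le_sum fun t _ => ?_
  have hm : ∀ u, Measurable fun ω => quadCost Qc (x t ω - u) := fun u =>
    (measurable_quadCost Qc).comp ((hx t).sub measurable_const)
  rw [stageCost, stageCost,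
    lintegral_eq_sum_fiber (hH (t + 1)) (f := fun h ω => quadCost Qc (x t ω - v t h))
      fun h => hm _,
    lintegral_eq_sum_fiber (hH (t + 1)) (f := fun h ω => quadCost Qc (x t ω - g.map t h))
      fun h => hm _]
  exact Finset.sum_le_sum fun h _ => hv t h _

end Receiver

/-! ### Dynamic programming against a fixed receiver -/

section DynamicProgramming

variable {n m : ℕ} {M : ℕ → ℕ}

/-- Measurable selection of a minimizer from a finite set. -/
theorem exists_measurable_argmin {α : Type*} [MeasurableSpace α] {k : ℕ} (hk : 0 < k)
    {f : Fin k → α → ℝ≥0∞} (hf : ∀ i, Measurable (f i)) :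
    ∃ φ : α → Fin k, Measurable φ ∧ ∀ a, f (φ a) a = ⨅ i, f i a := by
  have : Nonempty (Fin k) := ⟨⟨0, hk⟩⟩
  have hex : ∀ a, ∃ i, ∀ j, f i a ≤ f j a := fun a => Finite.exists_min fun i => f i a
  have hset : ∀ i, MeasurableSet {a | ∀ j, f i a ≤ f j a} := fun i => by
    rw [Set.ofPred_forall]
    exact MeasurableSet.iInter fun j => measurableSet_le (hf i) (hf j)
  classical
  -- Taking the least minimizing index makes each preimage a finite Boolean combination of the
  -- measurable sets `hset`.
  refine ⟨fun a => Fin.find _ (hex a), ?_, fun a => ?_⟩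
  · refine measurable_to_countable' fun i => ?_
    have : (fun a => Fin.find _ (hex a)) ⁻¹' {i} =
        {a | ∀ j, f i a ≤ f j a} ∩ ⋂ l : Fin k, ⋂ _ : l < i, {a | ∀ j, f l a ≤ f j a}ᶜ := by
      ext a
      simp [Fin.find_eq_iff]
    rw [this]
    exact (hset i).inter (MeasurableSet.iInter fun l => MeasurableSet.iInter fun _ =>
      (hset l).compl)
  · exact le_antisymm (le_iInf (Fin.find_spec (hex a))) (iInf_le _ _)

/-- Expected distortion and cost-to-go when the symbol `q` is sent at time `t` with filter state
`a` and past symbols `h`, where `μ`, `ν` are the laws of the filter error at time `t` and of the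
innovation at time `t + 1`. -/
noncomputable def actionCost (Qc A : Matrix (Fin n) (Fin n) ℝ) (K : Matrix (Fin n) (Fin m) ℝ)
    (μ : Measure (Fin n → ℝ)) (ν : Measure (Fin m → ℝ)) {t : ℕ}
    (g : History M (t + 1) → Fin n → ℝ) (V : (Fin n → ℝ) → History M (t + 1) → ℝ≥0∞)
    (a : Fin n → ℝ) (h : History M t) (q : Fin (M t)) : ℝ≥0∞ :=
  ∫⁻ z, quadCost Qc (a + z - g (h.snoc q)) ∂μ + ∫⁻ e, V (A *ᵥ a + K *ᵥ e) (h.snoc q) ∂ν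

/-- The optimal cost of the next `k` stages from time `t` on. -/
noncomputable def costToGo (Qc A : Matrix (Fin n) (Fin n) ℝ) (K : ℕ → Matrix (Fin n) (Fin m) ℝ)
    (μ : ℕ → Measure (Fin n → ℝ)) (ν : ℕ → Measure (Fin m → ℝ)) (g : ReceiverPolicy n M) :
    (k t : ℕ) → (Fin n → ℝ) → History M t → ℝ≥0∞
  | 0, _, _, _ => 0
  | k + 1, t, a, h => ⨅ q : Fin (M t), actionCost Qc A (K (t + 1)) (μ t) (ν (t + 1)) (g.map t)
      (costToGo Qc A K μ ν g k (t + 1)) a h q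

theorem measurable_actionCost (Qc A : Matrix (Fin n) (Fin n) ℝ) (K : Matrix (Fin n) (Fin m) ℝ)
    (μ : Measure (Fin n → ℝ)) (ν : Measure (Fin m → ℝ)) [SFinite μ] [SFinite ν] {t : ℕ}
    (g : History M (t + 1) → Fin n → ℝ) {V : (Fin n → ℝ) → History M (t + 1) → ℝ≥0∞}
    (hV : Measurable fun p : (Fin n → ℝ) × History M (t + 1) => V p.1 p.2) (q : Fin (M t)) :
    Measurable fun p : (Fin n → ℝ) × History M t => actionCost Qc A K μ ν g V p.1 p.2 q := by
  have hs : Measurable fun h : History M t => h.snoc q := Measurable.of_discrete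
  have hg : Measurable g := Measurable.of_discrete
  refine Measurable.add ?_ ?_
  · refine Measurable.lintegral_prod_right' (f := fun p : ((Fin n → ℝ) × History M t) ×
      (Fin n → ℝ) => quadCost Qc (p.1.1 + p.2 - g (p.1.2.snoc q))) ?_
    exact (measurable_quadCost Qc).comp
      (((measurable_fst.comp measurable_fst).add measurable_snd).sub
        ((hg.comp hs).comp (measurable_snd.comp measurable_fst)))
  · refine Measurable.lintegral_prod_right' (f := fun p : ((Fin n → ℝ) × History M t) ×
      (Fin m → ℝ) => V (A *ᵥ p.1.1 + K *ᵥ p.2) (p.1.2.snoc q)) ?_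
    refine hV.comp (Measurable.prodMk ?_ (hs.comp (measurable_snd.comp measurable_fst)))
    exact ((Continuous.matrix_mulVec continuous_const continuous_id).measurable.comp
      (measurable_fst.comp measurable_fst)).add
      ((Continuous.matrix_mulVec continuous_const continuous_id).measurable.comp measurable_snd)

theorem measurable_costToGo (Qc A : Matrix (Fin n) (Fin n) ℝ) (K : ℕ → Matrix (Fin n) (Fin m) ℝ)
    (μ : ℕ → Measure (Fin n → ℝ)) (ν : ℕ → Measure (Fin m → ℝ)) [∀ t, SFinite (μ t)]
    [∀ t, SFinite (ν t)] (g : ReceiverPolicy n M) (k t : ℕ) :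
    Measurable fun p : (Fin n → ℝ) × History M t => costToGo Qc A K μ ν g k t p.1 p.2 := by
  induction k generalizing t with
  | zero => exact measurable_const
  | succ k ih =>
    exact Measurable.iInf fun q => measurable_actionCost Qc A _ _ _ _ (ih (t + 1)) q

/-- Independence turns the joint law into a product, so Tonelli allows X to be averaged under its
own law with Y frozen. -/
theorem lintegral_comp_of_indepFun {Ω α β : Type*} [MeasurableSpace Ω] [MeasurableSpace α]
    [MeasurableSpace β] {P : Measure Ω} [IsFiniteMeasure P] {X : Ω → α} {Y : Ω → β}
    (hXY : IndepFun X Y P) (hX : Measurable X) (hY : Measurable Y) {f : α → β → ℝ≥0∞}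
    (hf : Measurable (Function.uncurry f)) :
    ∫⁻ ω, f (X ω) (Y ω) ∂P = ∫⁻ ω, ∫⁻ x, f x (Y ω) ∂(P.map X) ∂P := by
  have h1 : ∫⁻ ω, f (X ω) (Y ω) ∂P =
      ∫⁻ p, Function.uncurry f p ∂(P.map fun ω => (X ω, Y ω)) :=
    (lintegral_map hf (hX.prodMk hY)).symm
  rw [h1, (indepFun_iff_map_prod_eq_prod_map_map hX.aemeasurable hY.aemeasurable).1 hXY,
    lintegral_prod_symm _ hf.aemeasurable, lintegral_map hf.lintegral_prod_left' hY]
  rfl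

variable {Ω : Type*} [MeasurableSpace Ω] {P : Measure Ω} [IsProbabilityMeasure P]
  {A : Matrix (Fin n) (Fin n) ℝ} {C : Matrix (Fin m) (Fin n) ℝ}
  {Sig₀ W : Matrix (Fin n) (Fin n) ℝ} {R : Matrix (Fin m) (Fin m) ℝ}
  {x₀ : Ω → Fin n → ℝ} {w : ℕ → Ω → Fin n → ℝ} {r : ℕ → Ω → Fin m → ℝ}

/-- The Kalman filter state and the past symbols form a controlled Markov chain. -/
theorem IsGaussianSource.lintegral_step (h : IsGaussianSource P Sig₀ W R x₀ w r)
    (Qc : Matrix (Fin n) (Fin n) ℝ) (Q : CompositePolicy m M) (t : ℕ)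
    (g : History M (t + 1) → Fin n → ℝ) {V : (Fin n → ℝ) → History M (t + 1) → ℝ≥0∞}
    (hV : Measurable fun p : (Fin n → ℝ) × History M (t + 1) => V p.1 p.2) :
    ∫⁻ ω, quadCost Qc (state A x₀ w t ω -
        g (Q.history (fun u => observation A C x₀ w r u ω) (t + 1))) ∂P +
      ∫⁻ ω, V (filterMean A C Sig₀ W R x₀ w r (t + 1) ω)
        (Q.history (fun u => observation A C x₀ w r u ω) (t + 1)) ∂P =
    ∫⁻ ω, actionCost Qc A (kalmanGain C R (predCov A C Sig₀ W R (t + 1)))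
      (P.map fun ω => state A x₀ w t ω - filterMean A C Sig₀ W R x₀ w r t ω)
      (P.map (innovation A C Sig₀ W R x₀ w r (t + 1))) g V
      (filterMean A C Sig₀ W R x₀ w r t ω)
      (Q.history (fun u => observation A C x₀ w r u ω) t)
      (Q.output (fun u => observation A C x₀ w r u ω) t) ∂P := by
  -- Symbols through time t and the filter mean are functions of `Y`, so the filter error and the
  -- next innovation can each be averaged out with `Y` frozen.
  obtain ⟨φ, hφ, hφQ⟩ := Q.exists_history_eq t
  set Y : Ω → Fin (t + 1) → Fin m → ℝ := fun ω s => observation A C x₀ w r s ω with hY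
  have hYm : Measurable Y := measurable_pi_lambda _ fun s => h.measurable_observation s
  set K := kalmanGain C R (predCov A C Sig₀ W R (t + 1))
  set ψ := kalmanMean A C Sig₀ W R t with hψ
  have hψm : Measurable ψ := (continuous_kalmanMean t).measurable
  have hg : Measurable g := Measurable.of_discrete
  have hH : ∀ ω, Q.history (fun u => observation A C x₀ w r u ω) (t + 1) = φ (Y ω) :=
    fun ω => hφQ _
  have hzm : Measurable fun ω => state A x₀ w t ω - filterMean A C Sig₀ W R x₀ w r t ω :=
    (h.measurable_state t).sub (h.measurable_filterMean t)
  have hem := h.measurable_innovation (A := A) (C := C) t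
  have h1 := lintegral_comp_of_indepFun (h.indepFun_filterError (A := A) (C := C) t) hzm hYm
    (f := fun z y => quadCost Qc (ψ y + z - g (φ y))) ((measurable_quadCost Qc).comp
      (((hψm.comp measurable_snd).add measurable_fst).sub (hg.comp (hφ.comp measurable_snd))))
  have h2 := lintegral_comp_of_indepFun (h.indepFun_innovation (A := A) (C := C) t) hem hYm
    (f := fun e y => V (A *ᵥ ψ y + K *ᵥ e) (φ y)) (hV.comp (Measurable.prodMk
      (((Continuous.matrix_mulVec continuous_const continuous_id).measurable.comp
        (hψm.comp measurable_snd)).add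
        ((Continuous.matrix_mulVec continuous_const continuous_id).measurable.comp
          measurable_fst)) (hφ.comp measurable_snd)))
  have e1 : ∀ ω, state A x₀ w t ω =
      ψ (Y ω) + (state A x₀ w t ω - filterMean A C Sig₀ W R x₀ w r t ω) := by
    intro ω
    change _ = filterMean A C Sig₀ W R x₀ w r t ω + _
    abel
  have e2 : ∀ ω, filterMean A C Sig₀ W R x₀ w r (t + 1) ω =
      A *ᵥ ψ (Y ω) + K *ᵥ innovation A C Sig₀ W R x₀ w r (t + 1) ω :=
    fun ω => filterMean_eq A C Sig₀ W R x₀ w r (t + 1) ω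
  have h1' : ∫⁻ ω, quadCost Qc (state A x₀ w t ω - g (φ (Y ω))) ∂P = _ :=
    (lintegral_congr fun ω => by rw [← e1]).trans h1
  have h2' : ∫⁻ ω, V (filterMean A C Sig₀ W R x₀ w r (t + 1) ω) (φ (Y ω)) ∂P = _ :=
    (lintegral_congr fun ω => by rw [e2]).trans h2
  simp only [hH]
  rw [h1', h2', ← lintegral_add_left]
  · refine lintegral_congr fun ω => ?_
    simp only [actionCost, ← CompositePolicy.history_succ, hH]
    rfl
  · have : SFinite (P.map fun ω => state A x₀ w t ω - filterMean A C Sig₀ W R x₀ w r t ω) :=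
      inferInstance
    refine Measurable.lintegral_prod_left' (f := fun p : (Fin n → ℝ) × Ω =>
      quadCost Qc (ψ (Y p.2) + p.1 - g (φ (Y p.2)))) ((measurable_quadCost Qc).comp
      (((hψm.comp (hYm.comp measurable_snd)).add measurable_fst).sub
        (hg.comp (hφ.comp (hYm.comp measurable_snd)))))

/-- The cost-to-go with the laws of the filter errors and innovations of a Gaussian source. -/
noncomputable def sourceCostToGo (P : Measure Ω) (Qc A : Matrix (Fin n) (Fin n) ℝ)
    (C : Matrix (Fin m) (Fin n) ℝ) (Sig₀ W : Matrix (Fin n) (Fin n) ℝ)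
    (R : Matrix (Fin m) (Fin m) ℝ) (x₀ : Ω → Fin n → ℝ) (w : ℕ → Ω → Fin n → ℝ)
    (r : ℕ → Ω → Fin m → ℝ) (g : ReceiverPolicy n M) :
    (k t : ℕ) → (Fin n → ℝ) → History M t → ℝ≥0∞ :=
  costToGo Qc A (fun t => kalmanGain C R (predCov A C Sig₀ W R t))
    (fun t => P.map fun ω => state A x₀ w t ω - filterMean A C Sig₀ W R x₀ w r t ω)
    (fun t => P.map (innovation A C Sig₀ W R x₀ w r t)) g

/-- The cost of sending `q` at time `t` and continuing optimally for `k` further stages. -/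
noncomputable def sourceActionCost (P : Measure Ω) (Qc A : Matrix (Fin n) (Fin n) ℝ)
    (C : Matrix (Fin m) (Fin n) ℝ) (Sig₀ W : Matrix (Fin n) (Fin n) ℝ)
    (R : Matrix (Fin m) (Fin m) ℝ) (x₀ : Ω → Fin n → ℝ) (w : ℕ → Ω → Fin n → ℝ)
    (r : ℕ → Ω → Fin m → ℝ) (g : ReceiverPolicy n M) (k t : ℕ) :
    (Fin n → ℝ) → History M t → Fin (M t) → ℝ≥0∞ :=
  actionCost Qc A (kalmanGain C R (predCov A C Sig₀ W R (t + 1)))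
    (P.map fun ω => state A x₀ w t ω - filterMean A C Sig₀ W R x₀ w r t ω)
    (P.map (innovation A C Sig₀ W R x₀ w r (t + 1))) (g.map t)
    (sourceCostToGo P Qc A C Sig₀ W R x₀ w r g k (t + 1))

theorem measurable_sourceCostToGo (Qc : Matrix (Fin n) (Fin n) ℝ) (g : ReceiverPolicy n M)
    (k t : ℕ) : Measurable fun p : (Fin n → ℝ) × History M t =>
      sourceCostToGo P Qc A C Sig₀ W R x₀ w r g k t p.1 p.2 :=
  measurable_costToGo _ _ _ _ _ _ _ _

/-- The cost of any encoder is at least the optimal cost-to-go. -/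
theorem IsGaussianSource.lintegral_sourceCostToGo_le (h : IsGaussianSource P Sig₀ W R x₀ w r)
    (Qc : Matrix (Fin n) (Fin n) ℝ) (Q : CompositePolicy m M) (g : ReceiverPolicy n M) (k t : ℕ) :
    ∫⁻ ω, sourceCostToGo P Qc A C Sig₀ W R x₀ w r g k t (filterMean A C Sig₀ W R x₀ w r t ω)
        (Q.history (fun u => observation A C x₀ w r u ω) t) ∂P ≤
      ∑ s ∈ Finset.range k,
        stageCost P Qc (state A x₀ w) (observation A C x₀ w r) Q g (t + s) := by
  induction k generalizing t with
  | zero => simp [sourceCostToGo, costToGo]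
  | succ k ih =>
    rw [Finset.sum_range_succ']
    have hih := ih (t + 1)
    simp only [add_assoc, add_comm 1] at hih
    refine le_trans ?_ (add_le_add hih le_rfl)
    have := h.lintegral_step (A := A) (C := C) Qc Q t (g.map t)
      (measurable_sourceCostToGo (P := P) (A := A) (C := C) (Sig₀ := Sig₀) (W := W) (R := R)
        (x₀ := x₀) (w := w) (r := r) Qc g k (t + 1))
    refine le_trans ?_ (this.ge.trans (add_comm _ _).le)
    exact lintegral_mono fun ω => iInf_le _ _

/-- An encoder that always minimizes the cost-to-go attains it. -/
theorem IsGaussianSource.sum_lintegral_eq_sourceCostToGo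
    (h : IsGaussianSource P Sig₀ W R x₀ w r)
    (Qc : Matrix (Fin n) (Fin n) ℝ) (Q : CompositePolicy m M) (g : ReceiverPolicy n M) (T : ℕ)
    (hQ : ∀ k t, t + k + 1 = T → ∀ ω, sourceActionCost P Qc A C Sig₀ W R x₀ w r g k t
        (filterMean A C Sig₀ W R x₀ w r t ω)
        (Q.history (fun u => observation A C x₀ w r u ω) t)
        (Q.output (fun u => observation A C x₀ w r u ω) t) =
      ⨅ q, sourceActionCost P Qc A C Sig₀ W R x₀ w r g k t
        (filterMean A C Sig₀ W R x₀ w r t ω)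
        (Q.history (fun u => observation A C x₀ w r u ω) t) q)
    (k t : ℕ) (hkt : t + k = T) :
    ∑ s ∈ Finset.range k,
        stageCost P Qc (state A x₀ w) (observation A C x₀ w r) Q g (t + s) =
    ∫⁻ ω, sourceCostToGo P Qc A C Sig₀ W R x₀ w r g k t (filterMean A C Sig₀ W R x₀ w r t ω)
        (Q.history (fun u => observation A C x₀ w r u ω) t) ∂P := by
  induction k generalizing t with
  | zero => simp [sourceCostToGo, costToGo]
  | succ k ih =>
    rw [Finset.sum_range_succ', add_comm]
    have hih := ih (t + 1) (by omega)
    simp only [add_assoc, add_comm 1] at hih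
    rw [hih]
    have := h.lintegral_step (A := A) (C := C) Qc Q t (g.map t)
      (measurable_sourceCostToGo (P := P) (A := A) (C := C) (Sig₀ := Sig₀) (W := W) (R := R)
        (x₀ := x₀) (w := w) (r := r) Qc g k (t + 1))
    refine this.trans (lintegral_congr fun ω => ?_)
    exact hQ k t (by omega) ω

/-- For a fixed receiver, some encoder that uses only the Kalman filter is at least as good as any
given encoder. -/
theorem IsGaussianSource.exists_usesOnlyKalman_cost_le (h : IsGaussianSource P Sig₀ W R x₀ w r)
    {Qc : Matrix (Fin n) (Fin n) ℝ} (hQc : Qc.PosSemidef) (T : ℕ) (Q : CompositePolicy m M)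
    (g : ReceiverPolicy n M) :
    ∃ Q' : CompositePolicy m M, Q'.UsesOnlyKalman A C Sig₀ W R ∧
      cost P T Qc (state A x₀ w) (observation A C x₀ w r) Q' g ≤
        cost P T Qc (state A x₀ w) (observation A C x₀ w r) Q g := by
  -- T - (t + 1) stages remain after time t. For t ≥ T it truncates to 0, and those choices do not
  -- affect the cost.
  have hsel : ∀ t, ∃ φ : (Fin n → ℝ) × History M t → Fin (M t), Measurable φ ∧ ∀ p,
      sourceActionCost P Qc A C Sig₀ W R x₀ w r g (T - (t + 1)) t p.1 p.2 (φ p) =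
        ⨅ q, sourceActionCost P Qc A C Sig₀ W R x₀ w r g (T - (t + 1)) t p.1 p.2 q := by
    intro t
    rcases isEmpty_or_nonempty (History M t) with hE | ⟨⟨q₀⟩⟩
    · exact ⟨fun p => hE.elim p.2, measurable_of_empty _, fun p => hE.elim p.2⟩
    -- The alphabet is nonempty because the given policy produces a symbol from any history.
    · exact exists_measurable_argmin (Fin.pos (Q.map t 0 q₀)) fun q =>
        measurable_actionCost _ _ _ _ _ _ (measurable_sourceCostToGo _ _ _ _) q
  choose φ hφ hmin using hsel
  let Q' : CompositePolicy m M :=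
    { map := fun t y q => φ t (kalmanMean A C Sig₀ W R t y, q)
      measurable_map := fun t => (hφ t).comp
        (((continuous_kalmanMean t).measurable.comp measurable_fst).prodMk measurable_snd) }
  -- The error covariance is deterministic for each t, so the selector can discard that component.
  refine ⟨Q', ⟨fun t p => φ t (p.1, p.2.2), fun t => (hφ t).comp
    (measurable_fst.prodMk (measurable_snd.comp measurable_snd)), fun t y q => rfl⟩, ?_⟩
  have hx := h.measurable_state (A := A)
  have hy := h.measurable_observation (A := A) (C := C)
  have hopt := h.sum_lintegral_eq_sourceCostToGo (A := A) (C := C) Qc Q' g T (by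
    rintro k t rfl ω
    have := hmin t (filterMean A C Sig₀ W R x₀ w r t ω,
      Q'.history (fun u => observation A C x₀ w r u ω) t)
    rw [show t + k + 1 - (t + 1) = k by omega] at this
    rw [Q'.output_eq]
    exact this) T 0 (zero_add T)
  have hle := h.lintegral_sourceCostToGo_le (A := A) (C := C) Qc Q g T 0
  -- Both histories are empty at time 0, so the attained value and the lower bound are the same
  -- integral.
  have h0 : ∀ ω, Q'.history (fun u => observation A C x₀ w r u ω) 0 =
      Q.history (fun u => observation A C x₀ w r u ω) 0 := fun ω => funext fun s => s.elim0
  simp only [zero_add] at hopt hle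
  rw [cost_eq_sum hQc hx hy, cost_eq_sum hQc hx hy, hopt]
  simp only [h0]
  exact hle

end DynamicProgramming

end CausalLQG

theorem theorem7 {Ω : Type*} [MeasurableSpace Ω] (P : Measure Ω) [IsProbabilityMeasure P]
    {n m : ℕ} (A : Matrix (Fin n) (Fin n) ℝ) (C : Matrix (Fin m) (Fin n) ℝ)
    (Sig₀ W : Matrix (Fin n) (Fin n) ℝ) (R : Matrix (Fin m) (Fin m) ℝ)
    (x₀ : Ω → Fin n → ℝ) (w : ℕ → Ω → Fin n → ℝ) (r : ℕ → Ω → Fin m → ℝ)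
    (hsource : CausalLQG.IsGaussianSource P Sig₀ W R x₀ w r)
    (Qc : Matrix (Fin n) (Fin n) ℝ) (hQc : Qc.PosDef)
    (T : ℕ) (M : ℕ → ℕ) (Q : CausalLQG.CompositePolicy m M) :
    ∃ Q' : CausalLQG.CompositePolicy m M,
      Q'.UsesOnlyKalman A C Sig₀ W R ∧
      CausalLQG.performance P T Qc (CausalLQG.state A x₀ w)
          (CausalLQG.observation A C x₀ w r) Q'
        ≤ CausalLQG.performance P T Qc (CausalLQG.state A x₀ w)
          (CausalLQG.observation A C x₀ w r) Q := by

  obtain ⟨g, hg⟩ := CausalLQG.exists_optimal_receiver (T := T) hQc.posSemidef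
    (hsource.measurable_state (A := A))
    (fun t => hsource.memLp_coords (CausalLQG.coordsIn_state (A := A) t))
    (hsource.measurable_observation (A := A) (C := C)) Q
  obtain ⟨Q', hQ', hle⟩ :=
    hsource.exists_usesOnlyKalman_cost_le (A := A) (C := C) hQc.posSemidef T Q g
  exact ⟨Q', hQ', (iInf_le _ g).trans (hle.trans hg.ge)⟩
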